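/- Let $k$ be a field of characteristic zero and let $S$ be a set (finite or infinite). For a finite subset $F\subseteq S$ let $L(F)$ be the free Lie algebra over $k$ on $F$, graded so that the generators have degree $1$; let $L(F)_d$ be its degree-$d$ component, i.e. the span of the iterated brackets of $d$ generators. For finite subsets $F'\subseteq F$ of $S$ let $L(F)\to L(F')$ be the morphism of graded Lie algebras that fixes the generators in $F'$ and sends those in $F\setminus F'$ to $0$. Let $$L((S)):=\varprojlim_F L(F)=\bigoplus_{d}\varprojlim_F L(F)_d$$ be the inverse limit over all finite subsets $F\subseteq S$, taken in the category of graded Lie algebras over $k$; for finite $S$ it is the free Lie algebra $L(S)$. Write $L=L((S))$. Let $X\subseteq L$ be any set of homogeneous elements that projects to a basis of the vector space $L/[L,L]$, i.e. the family of the classes of the elements $x\in X$ is a $k$-basis of $L/[L,L]$. Then $L$ is freely generated as a Lie algebra by $X$: the canonical morphism from the free Lie algebra on the set $X$ to $L$ that extends the inclusion $X\hookrightarrow L$ is an isomorphism. -/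

import Mathlib

noncomputable section

namespace ProFreeLie

universe u v w

/-- `IsLieMonomial k X d m`: the element `m` of the free Lie algebra on `X` is an iterated bracket
of `d` generators, with any bracketing. -/
inductive IsLieMonomial (k : Type u) [CommRing k] (X : Type v) : ℕ → FreeLieAlgebra k X → Prop
  | of (x : X) : IsLieMonomial k X 1 (FreeLieAlgebra.of k x)
  | lie {i j : ℕ} {a b : FreeLieAlgebra k X} :
      IsLieMonomial k X i a → IsLieMonomial k X j b → IsLieMonomial k X (i + j) ⁅a, b⁆

/-- The degree `d` component of the free Lie algebra on `X`, where the generators have degree 1. -/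
def freeComponent (k : Type u) [CommRing k] (X : Type v) (d : ℕ) :
    Submodule k (FreeLieAlgebra k X) :=
  Submodule.span k {m | IsLieMonomial k X d m}

theorem lie_mem_freeComponent {k : Type u} [CommRing k] {X : Type v} {i j : ℕ}
    {a b : FreeLieAlgebra k X} (ha : a ∈ freeComponent k X i) (hb : b ∈ freeComponent k X j) :
    ⁅a, b⁆ ∈ freeComponent k X (i + j) := by
  induction ha using Submodule.span_induction with
  | mem a ha =>
    induction hb using Submodule.span_induction with
    | mem b hb => exact Submodule.subset_span (IsLieMonomial.lie ha hb)
    | zero => simp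
    | add b c _ _ hb hc => rw [lie_add]; exact add_mem hb hc
    | smul t b _ hb => rw [lie_smul]; exact Submodule.smul_mem _ t hb
  | zero => simp
  | add a c _ _ ha hc => rw [add_lie]; exact add_mem ha hc
  | smul t a _ ha => rw [smul_lie]; exact Submodule.smul_mem _ t ha

/-- The product of a family of Lie rings, with the componentwise bracket. -/
instance piLieRing {ι : Type u} {L : ι → Type v} [∀ i, LieRing (L i)] : LieRing (∀ i, L i) where
  bracket a b := fun i => ⁅a i, b i⁆
  add_lie _ _ _ := funext fun _ => add_lie _ _ _
  lie_add _ _ _ := funext fun _ => lie_add _ _ _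
  lie_self _ := funext fun _ => lie_self _
  leibniz_lie _ _ _ := funext fun _ => leibniz_lie _ _ _

instance piLieAlgebra {k : Type w} [CommRing k] {ι : Type u} {L : ι → Type v}
    [∀ i, LieRing (L i)] [∀ i, LieAlgebra k (L i)] : LieAlgebra k (∀ i, L i) where
  lie_smul _ _ _ := funext fun _ => lie_smul _ _ _

open Classical in
/-- The connecting morphism `L(F) → L(F')`, for finite subsets `F'` and `F` of `S`: it fixes the
generators in `F'` and annihilates those in `F \ F'`. It is used for `F' ⊆ F` only. -/
def restrict (k : Type u) [CommRing k] {S : Type v} (F F' : Finset S) :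
    FreeLieAlgebra k F →ₗ⁅k⁆ FreeLieAlgebra k F' :=
  FreeLieAlgebra.lift k fun s : F =>
    if h : (s : S) ∈ F' then FreeLieAlgebra.of k (⟨s, h⟩ : F') else 0

/-- The degree `d` component of the limit: the limit over the finite subsets `F` of `S`, along the
connecting morphisms, of the degree `d` components of the free Lie algebras `L(F)`. -/
def limComponent (k : Type u) [CommRing k] (S : Type v) (d : ℕ) :
    Submodule k (∀ F : Finset S, FreeLieAlgebra k F) where
  carrier := {a | (∀ F : Finset S, a F ∈ freeComponent k F d) ∧
    ∀ F F' : Finset S, F' ⊆ F → restrict k F F' (a F) = a F'}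
  zero_mem' := ⟨fun _ => zero_mem _, fun _ _ _ => by simp⟩
  add_mem' := fun {a b} ha hb => ⟨fun F => add_mem (ha.1 F) (hb.1 F),
    fun F F' h => by simp [ha.2 F F' h, hb.2 F F' h]⟩
  smul_mem' := fun t a ha => ⟨fun F => Submodule.smul_mem _ t (ha.1 F),
    fun F F' h => by simp [ha.2 F F' h]⟩

theorem lie_mem_limComponent {k : Type u} [CommRing k] {S : Type v} {i j : ℕ}
    {a b : ∀ F : Finset S, FreeLieAlgebra k F}
    (ha : a ∈ limComponent k S i) (hb : b ∈ limComponent k S j) :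
    ⁅a, b⁆ ∈ limComponent k S (i + j) :=
  ⟨fun F => lie_mem_freeComponent (ha.1 F) (hb.1 F), fun F F' h => by
    change restrict k F F' ⁅a F, b F⁆ = ⁅a F', b F'⁆
    rw [LieHom.map_lie, ha.2 F F' h, hb.2 F F' h]⟩

/-- The inverse limit `L((S))` of the free Lie algebras `L(F)`, `F ⊆ S` finite, in the category of
graded Lie algebras: the sum over all degrees `d` of the limits of the degree `d` components, inside
the product of the `L(F)`, with the componentwise bracket. -/
def limLie (k : Type u) [CommRing k] (S : Type v) :
    LieSubalgebra k (∀ F : Finset S, FreeLieAlgebra k F) where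
  toSubmodule := ⨆ d, limComponent k S d
  lie_mem' := by
    intro a b ha hb
    change a ∈ ⨆ d, limComponent k S d at ha
    change b ∈ ⨆ d, limComponent k S d at hb
    change ⁅a, b⁆ ∈ ⨆ d, limComponent k S d
    induction ha using Submodule.iSup_induction' with
    | mem i a ha =>
      induction hb using Submodule.iSup_induction' with
      | mem j b hb => exact Submodule.mem_iSup_of_mem (i + j) (lie_mem_limComponent ha hb)
      | zero => simp
      | add b c _ _ hb hc => rw [lie_add]; exact add_mem hb hc
    | zero => simp
    | add a c _ _ ha hc => rw [add_lie]; exact add_mem ha hc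

/-- An element of `L((S))` is homogeneous if it lies in one of the graded components. -/
def IsHomogeneous {k : Type u} [CommRing k] {S : Type v} (a : limLie k S) : Prop :=
  ∃ d : ℕ, (a : ∀ F : Finset S, FreeLieAlgebra k F) ∈ limComponent k S d

/-- The projection of a Lie algebra `L` to the vector space `L / [L, L]`. -/
abbrev abProj (k : Type u) [CommRing k] {L : Type v} [LieRing L] [LieAlgebra k L] (a : L) :
    L ⧸ ⁅(⊤ : LieIdeal k L), (⊤ : LieIdeal k L)⁆ :=
  LieSubmodule.Quotient.mk a

/-- A Lie algebra `L` is freely generated by a subset `X` if the canonical morphism from the free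
Lie algebra on `X` to `L` is an isomorphism. -/
def IsFreelyGeneratedBy (k : Type u) [CommRing k] {L : Type v} [LieRing L] [LieAlgebra k L]
    (X : Set L) : Prop :=
  Function.Bijective (FreeLieAlgebra.lift k (fun x : X => (x : L)))

end ProFreeLie

end

/-! `L((S))` acts on formal noncommutative series in `S` by left multiplication (`limMul`); a
homogeneous element of degree `d` acts as multiplication by a homogeneous series of degree `d`. The
Dynkin map `D`, turning words into right-normed brackets, survives the limit and satisfies `D(a·1) =
d a` and, in positive degree, `D(a·b) = ⁅a, D b⁆`.

Generation: `a ↦ D(a·1)` is, up to the invertible factor `d`, the projection to degree `d`, so `L =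
span X + [L, L]` can be read degree by degree and induction on `d` applies.

Freeness: in a relation `∑ x·b_x = 0`, apply `D` to initial segments of words and reduce modulo `[L,
L]`. Only a linear relation among classes of elements of `X` remains, so `b = 0`
(`eq_zero_of_sum_limMul_eq_zero`). Stripping first factors, products of elements of `X` are linearly
independent (`wordMap_limMul_injective`). The free Lie algebra on `X` embeds in the span of words in
`X`, again by Dynkin (`eq_zero_of_wordAction_eq_zero`), hence in `L((S))`. -/

noncomputable section

namespace ProFreeLie

attribute [local instance] LieRing.ofAssociativeRing

/-! ### Grading of the free Lie algebra. -/

section FreeLie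

variable {k : Type*} [CommRing k] {X : Type*}

/-- A property of homogeneous elements that holds for the generators and is stable under linear
combinations and brackets holds for all homogeneous elements. -/
theorem freeComponent_induction {P : ℕ → FreeLieAlgebra k X → Prop}
    (of : ∀ x, P 1 (FreeLieAlgebra.of k x)) (zero : ∀ d, P d 0)
    (add : ∀ d a b, P d a → P d b → P d (a + b)) (smul : ∀ d (t : k) a, P d a → P d (t • a))
    (lie : ∀ i j a b, 1 ≤ i → 1 ≤ j → a ∈ freeComponent k X i → b ∈ freeComponent k X j →
      P i a → P j b → P (i + j) ⁅a, b⁆) {d : ℕ}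
    {a : FreeLieAlgebra k X} (ha : a ∈ freeComponent k X d) : P d a := by
  induction ha using Submodule.span_induction with
  | mem m hm =>
    have : 1 ≤ d ∧ P d m := by
      induction hm with
      | of x => exact ⟨le_rfl, of x⟩
      | lie ha hb iha ihb =>
        exact ⟨by omega, lie _ _ _ _ iha.1 ihb.1 (Submodule.subset_span ha)
          (Submodule.subset_span hb) iha.2 ihb.2⟩
    exact this.2
  | zero => exact zero d
  | add a b _ _ ha hb => exact add d a b ha hb
  | smul t a _ ha => exact smul d t a ha

theorem eq_zero_of_mem_freeComponent_zero {a : FreeLieAlgebra k X}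
    (ha : a ∈ freeComponent k X 0) : a = 0 := by
  refine freeComponent_induction (P := fun d a => d = 0 → a = 0) ?_ ?_ ?_ ?_ ?_ ha rfl
  · simp
  · simp
  · intro d a b ha hb hd
    simp [ha hd, hb hd]
  · intro d t a ha hd
    simp [ha hd]
  · intro i j a b hi _ _ _ _ _ h
    omega

theorem iSup_freeComponent : ⨆ d, freeComponent k X d = ⊤ := by
  let H : LieSubalgebra k (FreeLieAlgebra k X) :=
    { toSubmodule := ⨆ d, freeComponent k X d
      lie_mem' := by
        intro a b ha hb
        change a ∈ ⨆ d, freeComponent k X d at ha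
        change b ∈ ⨆ d, freeComponent k X d at hb
        change ⁅a, b⁆ ∈ ⨆ d, freeComponent k X d
        induction ha using Submodule.iSup_induction' with
        | mem i a ha =>
          induction hb using Submodule.iSup_induction' with
          | mem j b hb => exact Submodule.mem_iSup_of_mem (i + j) (lie_mem_freeComponent ha hb)
          | zero => simp
          | add b c _ _ hb hc => rw [lie_add]; exact add_mem hb hc
        | zero => simp
        | add a c _ _ ha hc => rw [add_lie]; exact add_mem ha hc }
  have hof : ∀ x : X, FreeLieAlgebra.of k x ∈ H := fun x =>
    Submodule.mem_iSup_of_mem 1 (Submodule.subset_span (IsLieMonomial.of x))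
  have hid : H.incl.comp (FreeLieAlgebra.lift k fun x => (⟨_, hof x⟩ : H)) = LieHom.id := by
    ext x
    simp
  rw [eq_top_iff]
  intro a _
  have := LieHom.congr_fun hid a
  rw [LieHom.id_apply] at this
  rw [← this]
  exact (FreeLieAlgebra.lift k (fun x => (⟨_, hof x⟩ : H)) a).2

end FreeLie

/-! ### Embedding of the free Lie algebra into the span of words. -/

section WordMap

variable {k : Type*} [CommRing k] {X : Type*} {V : Type*} [AddCommGroup V] [Module k V]

/-- The action of the free Lie algebra on the span of the words, by multiplication from the left. -/
def wordAction (k : Type*) [CommRing k] (X : Type*) :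
    FreeLieAlgebra k X →ₗ⁅k⁆ Module.End k (List X →₀ k) :=
  FreeLieAlgebra.lift k fun x => Finsupp.lmapDomain k k (List.cons x)

/-- The value at `v` of the operator that is attached to a word. -/
def wordValue (f : X → Module.End k V) (v : V) : List X → V
  | [] => v
  | x :: w => f x (wordValue f v w)

/-- The linear map on the span of the words that sends a word to the value at `v` of the attached
operator. -/
def wordMap (f : X → Module.End k V) (v : V) : (List X →₀ k) →ₗ[k] V :=
  Finsupp.linearCombination k (wordValue f v)

/-- For a generator this is the recursion of `wordValue`; intertwining passes to commutators. -/
theorem wordMap_wordAction (f : X → Module.End k V) (v : V) (a : FreeLieAlgebra k X)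
    (c : List X →₀ k) :
    wordMap f v (wordAction k X a c) = FreeLieAlgebra.lift k f a (wordMap f v c) := by
  have ha : a ∈ ⨆ d, freeComponent k X d := by simp [iSup_freeComponent]
  induction ha using Submodule.iSup_induction' generalizing c with
  | mem d a ha =>
    revert c
    refine freeComponent_induction (P := fun _ a => ∀ c, wordMap f v (wordAction k X a c) =
      FreeLieAlgebra.lift k f a (wordMap f v c)) ?_ ?_ ?_ ?_ ?_ ha
    · intro x c
      induction c using Finsupp.induction_linear with
      | zero => simp
      | add c d hc hd => simp only [map_add, hc, hd]
      | single w r => simp [wordMap, wordAction, wordValue]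
    · simp
    · intro d a b ha hb c
      simp [ha, hb]
    · intro d t a ha c
      simp [ha]
    · intro i j a b _ _ _ _ ha hb c
      simp only [LieHom.map_lie, LieRing.of_associative_ring_bracket, LinearMap.sub_apply,
        Module.End.mul_apply, map_sub, ha, hb]
  | zero => simp
  | add a b _ _ ha hb => simp [ha, hb]

/-- The action of a generator `x` on `k × L(X)`: it sends `(c, l)` to `(0, c x + ⁅x, l⁆)`. -/
def dynkinAction (k : Type*) [CommRing k] {X : Type*} (x : X) :
    Module.End k (k × FreeLieAlgebra k X) :=
  LinearMap.inr k k _ ∘ₗ (LinearMap.toSpanSingleton k _ (FreeLieAlgebra.of k x)).coprod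
    (LieAlgebra.ad k _ (FreeLieAlgebra.of k x))

/-- This is the adjoint action on `L(X)` extended by minus the degree derivation, which is
represented by `(1, 0)`. -/
theorem lift_dynkinAction {d : ℕ} {a : FreeLieAlgebra k X} (ha : a ∈ freeComponent k X d) :
    ∀ (c : k) (l : FreeLieAlgebra k X),
      FreeLieAlgebra.lift k (dynkinAction k) a (c, l) = (0, c • d • a + ⁅a, l⁆) := by
  refine freeComponent_induction (P := fun d a => ∀ (c : k) (l : FreeLieAlgebra k X),
      FreeLieAlgebra.lift k (dynkinAction k) a (c, l) = (0, c • d • a + ⁅a, l⁆)) ?_ ?_ ?_ ?_ ?_ ha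
  · intro x c l
    simp [dynkinAction]
  · simp [Prod.mk_zero_zero]
  · intro d a b ha hb c l
    simp [ha, hb]
    abel
  · intro d t a ha c l
    simp [ha, smul_comm c t, smul_comm d t]
  · intro i j a b _ _ _ _ ha hb c l
    simp only [LieHom.map_lie, LieRing.of_associative_ring_bracket, LinearMap.sub_apply,
        Module.End.mul_apply, ha, hb, Prod.mk_sub_mk, lie_add, lie_smul, zero_smul, zero_add,
        sub_self, lie_nsmul, lie_lie]
    rw [← lie_skew b a]
    simp only [smul_neg, add_smul, smul_add, Prod.mk.injEq, true_and]
    abel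

/-- Over a field of characteristic zero, the free Lie algebra acts freely on the empty word. -/
theorem eq_zero_of_wordAction_eq_zero {k : Type*} [Field k] [CharZero k] {X : Type*}
    {a : FreeLieAlgebra k X} (ha : wordAction k X a (Finsupp.single [] 1) = 0) : a = 0 := by
  -- `E` is multiplication by `d` in degree `d`, so a kernel element is an eigenvector for `0`,
  -- while `L(X)` is spanned by eigenvectors for nonzero eigenvalues.
  let E : Module.End k (FreeLieAlgebra k X) := LinearMap.snd k k _ ∘ₗ
    (LinearMap.applyₗ ((1 : k), (0 : FreeLieAlgebra k X))) ∘ₗ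
      (FreeLieAlgebra.lift k (dynkinAction k)).toLinearMap
  have hE : E a = 0 := by
    have := wordMap_wordAction (dynkinAction k) (1, 0) a (Finsupp.single [] 1)
    rw [ha, map_zero] at this
    have h2 : wordMap (dynkinAction k) ((1 : k), (0 : FreeLieAlgebra k X))
      (Finsupp.single [] 1) = (1, 0) := by simp [wordMap, wordValue]
    rw [h2] at this
    simp [E, ← this]
  have hcomp : ∀ d, freeComponent k X d ≤ E.eigenspace (d : k) := by
    intro d a ha
    rw [Module.End.mem_eigenspace_iff]
    simp [E, lift_dynkinAction ha, Nat.cast_smul_eq_nsmul]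
  have hdisj := E.eigenspaces_iSupIndep (0 : k)
  have htop : (⊤ : Submodule k (FreeLieAlgebra k X)) ≤
      ⨆ (μ : k) (_ : μ ≠ 0), E.eigenspace μ := by
    rw [← iSup_freeComponent, iSup_le_iff]
    intro d
    rcases Nat.eq_zero_or_pos d with rfl | hd
    · intro b hb
      rw [eq_zero_of_mem_freeComponent_zero hb]
      exact zero_mem _
    · exact (hcomp d).trans (le_iSup₂_of_le (d : k) (by exact_mod_cast hd.ne') le_rfl)
  refine (Submodule.disjoint_def.1 hdisj) a ?_ (htop trivial)
  rw [Module.End.mem_eigenspace_iff, hE, zero_smul]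

end WordMap

/-! ### Left multiplication and the Dynkin map for finitely many letters. -/

section Words

variable {k : Type*} [CommRing k] {S : Type*}

open Classical in
/-- Multiplication by the letter `s` from the left, on formal sums of words in `S`. -/
def letterMul (k : Type*) [CommRing k] {S : Type*} (s : S) : Module.End k (List S → k) where
  toFun b
    | [] => 0
    | t :: w => if t = s then b w else 0
  map_add' b c := by
    ext (_ | ⟨t, w⟩)
    · simp
    · by_cases h : t = s <;> simp [h]
  map_smul' r b := by
    ext (_ | ⟨t, w⟩)
    · simp
    · by_cases h : t = s <;> simp [h]

@[simp]
theorem letterMul_nil (s : S) (b : List S → k) : letterMul k s b [] = 0 := rfl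

open Classical in
theorem letterMul_cons (s t : S) (b : List S → k) (w : List S) :
    letterMul k s b (t :: w) = if t = s then b w else 0 := rfl

open Classical in
/-- The formal sum that consists of the empty word. -/
def emptyWord (k : Type*) [CommRing k] (S : Type*) : List S → k :=
  fun w => if w = [] then 1 else 0

/-- The action of `L(F)` on formal sums of words, by multiplication from the left. -/
def leftMul (k : Type*) [CommRing k] {S : Type*} (F : Finset S) :
    FreeLieAlgebra k F →ₗ⁅k⁆ Module.End k (List S → k) :=
  FreeLieAlgebra.lift k fun s : F => letterMul k (s : S)

theorem leftMul_apply {F : Finset S} {d : ℕ} {a : FreeLieAlgebra k F}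
    (ha : a ∈ freeComponent k F d) (b : List S → k) (w : List S) :
    leftMul k F a b w =
      if d ≤ w.length then leftMul k F a (emptyWord k S) (w.take d) * b (w.drop d) else 0 := by
  -- It suffices to find some coefficient function `c`: evaluation at the empty word identifies it.
  suffices h : ∃ c : List S → k, ∀ (b : List S → k) (w : List S), leftMul k F a b w =
      if d ≤ w.length then c (w.take d) * b (w.drop d) else 0 by
    obtain ⟨c, hc⟩ := h
    rw [hc b w]
    split_ifs with hd
    · rw [hc _ (w.take d)]
      simp [hd, emptyWord, List.take_take]
    · rfl
  clear b w
  refine freeComponent_induction (P := fun d a => ∃ c : List S → k, ∀ (b : List S → k)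
      (w : List S), leftMul k F a b w =
      if d ≤ w.length then c (w.take d) * b (w.drop d) else 0) ?_ ?_ ?_ ?_ ?_ ha
  · intro s
    refine ⟨letterMul k (s : S) (emptyWord k S), fun b w => ?_⟩
    rcases w with _ | ⟨t, w⟩
    · simp [leftMul]
    · simp [leftMul, letterMul_cons, emptyWord]
  · exact fun d => ⟨0, fun b w => by simp⟩
  · rintro d a a' ⟨c, hc⟩ ⟨c', hc'⟩
    refine ⟨c + c', fun b w => ?_⟩
    simp only [map_add, LinearMap.add_apply, Pi.add_apply, hc, hc']
    split_ifs
    · ring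
    · simp
  · rintro d t a ⟨c, hc⟩
    refine ⟨t • c, fun b w => ?_⟩
    simp only [map_smul, LinearMap.smul_apply, Pi.smul_apply, hc, smul_eq_mul]
    split_ifs
    · ring
    · simp
  · rintro i j a a' _ _ _ _ ⟨c, hc⟩ ⟨c', hc'⟩
    refine ⟨fun w => c (w.take i) * c' (w.drop i) - c' (w.take j) * c (w.drop j),
      fun b w => ?_⟩
    simp only [LieHom.map_lie, LieRing.of_associative_ring_bracket, LinearMap.sub_apply,
      Module.End.mul_apply, Pi.sub_apply, hc, hc', List.length_drop, List.drop_drop,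
      List.take_take]
    by_cases h : i + j ≤ w.length
    · have h1 : i ≤ w.length := by omega
      have h2 : j ≤ w.length := by omega
      have h3 : j ≤ w.length - i := by omega
      have h4 : i ≤ w.length - j := by omega
      simp only [h, h1, h2, h3, h4, if_true, List.drop_take, Nat.add_sub_cancel_left,
        Nat.add_sub_cancel, min_eq_left (Nat.le_add_right i j), min_eq_left (Nat.le_add_left j i),
        add_comm j i]
      ring
    · have h3 : i ≤ w.length → ¬ j ≤ w.length - i := by omega
      have h4 : j ≤ w.length → ¬ i ≤ w.length - j := by omega
      rw [if_neg h]
      by_cases h1 : i ≤ w.length <;> by_cases h2 : j ≤ w.length <;> simp [h1, h2, h3, h4]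

/-- A generator outside `F'` only produces words containing that letter. Allowing `b ≠ b'` outside
the words in `F'` keeps the induction going through products. -/
theorem leftMul_restrict {F F' : Finset S} (a : FreeLieAlgebra k F)
    {b b' : List S → k} (hb : ∀ w : List S, (∀ s ∈ w, s ∈ F') → b w = b' w) {w : List S}
    (hw : ∀ s ∈ w, s ∈ F') :
    leftMul k F' (restrict k F F' a) b w = leftMul k F a b' w := by
  have ha : a ∈ ⨆ d, freeComponent k F d := by simp [iSup_freeComponent]
  induction ha using Submodule.iSup_induction' with
  | mem d a ha =>
    revert b b' w
    refine freeComponent_induction (P := fun _ a => ∀ {b b' : List S → k},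
      (∀ w : List S, (∀ s ∈ w, s ∈ F') → b w = b' w) → ∀ {w : List S}, (∀ s ∈ w, s ∈ F') →
      leftMul k F' (restrict k F F' a) b w = leftMul k F a b' w) ?_ ?_ ?_ ?_ ?_ ha
    · intro s b b' hb w hw
      rcases w with _ | ⟨t, w⟩
      · by_cases hs : (s : S) ∈ F' <;> simp [leftMul, restrict, hs]
      · have hbw := hb w fun r hr => hw r (List.mem_cons_of_mem _ hr)
        by_cases hs : (s : S) ∈ F'
        · simp [leftMul, restrict, hs, letterMul_cons, hbw]
        · have : t ≠ s := fun h => hs (h ▸ hw t List.mem_cons_self)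
          simp [leftMul, restrict, hs, letterMul_cons, this]
    · simp
    · intro d a a' ha ha' b b' hb w hw
      simp [ha hb hw, ha' hb hw]
    · intro d t a ha b b' hb w hw
      simp [ha hb hw]
    · intro i j a a' _ _ _ _ ha ha' b b' hb w hw
      simp only [LieHom.map_lie, LieRing.of_associative_ring_bracket, LinearMap.sub_apply,
        Module.End.mul_apply, Pi.sub_apply]
      rw [ha (fun w hw => ha' hb hw) hw, ha' (fun w hw => ha hb hw) hw]
  | zero => simp
  | add a b _ _ ha hb => simp [ha, hb]

/-- The Dynkin map in degree `d`: it sends a formal sum of words to the corresponding combination of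
right-normed brackets of its words of length `d` in the letters of `F`. -/
def dynkin (k : Type*) [CommRing k] {S : Type*} (F : Finset S) :
    ℕ → ((List S → k) →ₗ[k] FreeLieAlgebra k F)
  | 0 => 0
  | 1 => ∑ s : F, (LinearMap.proj [(s : S)]).smulRight (FreeLieAlgebra.of k s)
  | d + 2 => ∑ s : F, (LieAlgebra.ad k _ (FreeLieAlgebra.of k s)).comp
      ((dynkin k F (d + 1)).comp (LinearMap.funLeft k k (List.cons (s : S))))

theorem dynkin_one (F : Finset S) (b : List S → k) :
    dynkin k F 1 b = ∑ s : F, b [(s : S)] • FreeLieAlgebra.of k s := by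
  simp [dynkin]

theorem dynkin_succ (F : Finset S) {d : ℕ} (hd : 1 ≤ d) (b : List S → k) :
    dynkin k F (d + 1) b =
      ∑ s : F, ⁅FreeLieAlgebra.of k s, dynkin k F d fun w => b ((s : S) :: w)⁆ := by
  obtain ⟨d, rfl⟩ := Nat.exists_eq_add_of_le' hd
  simp only [dynkin, LinearMap.sum_apply, LinearMap.comp_apply, LieAlgebra.ad_apply]
  rfl

theorem dynkin_congr {F : Finset S} {d : ℕ} {b b' : List S → k}
    (h : ∀ w : List S, w.length = d → (∀ s ∈ w, s ∈ F) → b w = b' w) :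
    dynkin k F d b = dynkin k F d b' := by
  rcases Nat.eq_zero_or_pos d with rfl | hd
  · rfl
  induction d, hd using Nat.le_induction generalizing b b' with
  | base =>
    simp only [dynkin_one]
    exact Finset.sum_congr rfl fun s _ => by rw [h [(s : S)] rfl (by simp)]
  | succ d hd ih =>
    simp only [dynkin_succ F hd]
    refine Finset.sum_congr rfl fun s _ => ?_
    rw [ih fun w hw hF => h _ (by simp [hw]) (by simpa using hF)]

theorem dynkin_mem (F : Finset S) (d : ℕ) (b : List S → k) :
    dynkin k F d b ∈ freeComponent k F d := by
  have hof (s : F) : FreeLieAlgebra.of k s ∈ freeComponent k F 1 :=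
    Submodule.subset_span (IsLieMonomial.of s)
  rcases Nat.eq_zero_or_pos d with rfl | hd
  · exact zero_mem _
  induction d, hd using Nat.le_induction generalizing b with
  | base =>
    rw [dynkin_one]
    exact sum_mem fun s _ => Submodule.smul_mem _ _ (hof s)
  | succ d hd ih =>
    rw [dynkin_succ F hd, add_comm d 1]
    exact sum_mem fun s _ => lie_mem_freeComponent (hof s) (ih _)

theorem restrict_dynkin {F F' : Finset S} (hF : F' ⊆ F) (d : ℕ) (b : List S → k) :
    restrict k F F' (dynkin k F d b) = dynkin k F' d b := by
  classical
  have hsum (f : F → FreeLieAlgebra k F') (g : F' → FreeLieAlgebra k F')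
      (hfg : ∀ (s : F) (h : (s : S) ∈ F'), f s = g ⟨s, h⟩)
      (hf : ∀ s : F, (s : S) ∉ F' → f s = 0) : ∑ s, f s = ∑ s, g s := by
    symm
    refine Finset.sum_of_injOn (fun s : F' => (⟨s, hF s.2⟩ : F)) ?_ ?_ ?_ ?_
    · intro s _ t _ h
      exact Subtype.ext (congrArg (fun r : F => (r : S)) h)
    · simp
    · intro s _ hs
      refine hf s fun h => hs ⟨⟨s, h⟩, by simp, rfl⟩
    · intro s _
      exact (hfg ⟨s, hF s.2⟩ s.2).symm
  rcases Nat.eq_zero_or_pos d with rfl | hd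
  · exact map_zero _
  induction d, hd using Nat.le_induction generalizing b with
  | base =>
    simp only [dynkin_one, map_sum, map_smul]
    apply hsum
    · intro s h
      simp [restrict, h]
    · intro s h
      simp [restrict, h]
  | succ d hd ih =>
    simp only [dynkin_succ _ hd, map_sum, LieHom.map_lie, ih]
    apply hsum
    · intro s h
      simp [restrict, h]
    · intro s h
      simp [restrict, h]

/-- The recursion of `dynkin` gives the case of a letter, the Jacobi identity that of a bracket.
Degree `d = 0` is excluded: the empty word obeys the next identity instead. -/
theorem dynkin_leftMul {F : Finset S} {i : ℕ} {a : FreeLieAlgebra k F}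
    (ha : a ∈ freeComponent k F i) : ∀ {d : ℕ}, 1 ≤ d → ∀ b : List S → k,
    dynkin k F (i + d) (leftMul k F a b) = ⁅a, dynkin k F d b⁆ := by
  refine freeComponent_induction (P := fun i a => ∀ {d : ℕ}, 1 ≤ d → ∀ b : List S → k,
    dynkin k F (i + d) (leftMul k F a b) = ⁅a, dynkin k F d b⁆) ?_ ?_ ?_ ?_ ?_ ha
  · intro s d hd b
    rw [add_comm 1 d, dynkin_succ F hd, Finset.sum_eq_single s]
    · congr 2
      ext w
      simp [leftMul, letterMul_cons]
    · intro t _ ht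
      have : (fun w => leftMul k F (FreeLieAlgebra.of k s) b ((t : S) :: w)) = 0 := by
        ext w
        simp [leftMul, letterMul_cons, Subtype.coe_injective.ne ht]
      rw [this, map_zero, lie_zero]
    · simp
  · simp
  · intro i a a' ha ha' d hd b
    simp [ha hd, ha' hd]
  · intro i t a ha d hd b
    simp [ha hd]
  · intro i j a a' hi hj _ _ ha ha' d hd b
    simp only [LieHom.map_lie, LieRing.of_associative_ring_bracket, LinearMap.sub_apply,
        Module.End.mul_apply, map_sub, lie_lie]
    rw [add_assoc, ha (by omega), ha' hd, ← add_assoc, add_comm i j, add_assoc, ha' (by omega),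
      ha hd]

/-- For a bracket, the two products contribute `j ⁅a, a'⁆` and `-i ⁅a', a⁆`, in total `(i + j) ⁅a,
a'⁆`. -/
theorem dynkin_leftMul_emptyWord {F : Finset S} {i : ℕ} {a : FreeLieAlgebra k F}
    (ha : a ∈ freeComponent k F i) :
    dynkin k F i (leftMul k F a (emptyWord k S)) = i • a := by
  refine freeComponent_induction (P := fun i a =>
    dynkin k F i (leftMul k F a (emptyWord k S)) = i • a) ?_ ?_ ?_ ?_ ?_ ha
  · intro s
    rw [dynkin_one, Finset.sum_eq_single s]
    · simp [leftMul, letterMul_cons, emptyWord]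
    · intro t _ ht
      simp [leftMul, letterMul_cons, Subtype.coe_injective.ne ht]
    · simp
  · simp
  · intro i a a' ha ha'
    simp [ha, ha']
  · intro i t a ha
    simp [ha, smul_comm i t]
  · intro i j a a' hi hj ha ha' iha iha'
    simp only [LieHom.map_lie, LieRing.of_associative_ring_bracket, LinearMap.sub_apply,
        Module.End.mul_apply, map_sub]
    rw [dynkin_leftMul ha hj, add_comm i j, dynkin_leftMul ha' hi, iha, iha', lie_nsmul, lie_nsmul,
      ← lie_skew a a', smul_neg, smul_neg, add_smul]
    abel

end Words

/-! ### Series action and Dynkin map on `L((S))`. -/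

section Limit

variable {k : Type*} [CommRing k] {S : Type*}

theorem restrict_limLie (a : limLie k S) {F F' : Finset S} (hF : F' ⊆ F) :
    restrict k F F' (a.1 F) = a.1 F' := by
  obtain ⟨a, ha⟩ := a
  change a ∈ ⨆ d, limComponent k S d at ha
  change restrict k F F' (a F) = a F'
  induction ha using Submodule.iSup_induction' with
  | mem d a ha => exact ha.2 F F' hF
  | zero => simp
  | add a b _ _ ha hb => simp [ha, hb]

open Classical in
theorem leftMul_limLie (a : limLie k S) (b : List S → k) {F : Finset S} {w : List S}
    (hw : ∀ s ∈ w, s ∈ F) :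
    leftMul k w.toFinset (a.1 w.toFinset) b w = leftMul k F (a.1 F) b w := by
  rw [← restrict_limLie a (fun s hs => hw s (List.mem_toFinset.1 hs)),
    leftMul_restrict _ (fun _ _ => rfl) (fun s hs => List.mem_toFinset.2 hs)]

open Classical in
/-- The action of `L((S))` on formal sums of words, by multiplication from the left. -/
def limMul (k : Type*) [CommRing k] (S : Type*) :
    limLie k S →ₗ⁅k⁆ Module.End k (List S → k) where
  toFun a :=
    { toFun := fun b w => leftMul k w.toFinset (a.1 w.toFinset) b w
      map_add' := fun b c => by ext w; simp
      map_smul' := fun r b => by ext w; simp }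
  map_add' a a' := by
    ext b w
    change leftMul k w.toFinset (a.1 w.toFinset + a'.1 w.toFinset) b w = _
    simp
  map_smul' r a := by
    ext b w
    change leftMul k w.toFinset (r • a.1 w.toFinset) b w = _
    simp
  map_lie' := by
    intro a a'
    ext b w
    have key (a a' : limLie k S) : leftMul k w.toFinset (a.1 w.toFinset)
        (fun v => leftMul k v.toFinset (a'.1 v.toFinset) b v) w =
        leftMul k w.toFinset (a.1 w.toFinset) (leftMul k w.toFinset (a'.1 w.toFinset) b) w := by
      -- The inner coefficient at `v` uses only the letters of `v`. Viewing `a` as its restriction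
      -- from the letters of `w` to themselves lets `leftMul_restrict` replace them by those of `w`.
      conv_lhs => rw [← restrict_limLie a (Finset.Subset.refl w.toFinset)]
      exact leftMul_restrict _ (fun v hv => leftMul_limLie a' b hv)
        (fun s hs => List.mem_toFinset.2 hs)
    change leftMul k w.toFinset ⁅a.1 w.toFinset, a'.1 w.toFinset⁆ b w =
      leftMul k w.toFinset (a.1 w.toFinset)
        (fun v => leftMul k v.toFinset (a'.1 v.toFinset) b v) w -
      leftMul k w.toFinset (a'.1 w.toFinset)
        (fun v => leftMul k v.toFinset (a.1 v.toFinset) b v) w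
    rw [key, key, LieHom.map_lie]
    rfl

theorem limMul_apply_of_subset (a : limLie k S) (b : List S → k) {F : Finset S} {w : List S}
    (hw : ∀ s ∈ w, s ∈ F) : limMul k S a b w = leftMul k F (a.1 F) b w := by
  classical
  rw [← leftMul_limLie a b hw]
  rfl

/-- The degree `d` component, as a subspace of `L((S))`. -/
def component (k : Type*) [CommRing k] (S : Type*) (d : ℕ) : Submodule k (limLie k S) :=
  (limComponent k S d).comap (limLie k S).toSubmodule.subtype

theorem lie_mem_component {i j : ℕ} {a b : limLie k S} (ha : a ∈ component k S i)
    (hb : b ∈ component k S j) : ⁅a, b⁆ ∈ component k S (i + j) :=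
  lie_mem_limComponent (a := a.1) (b := b.1) ha hb

theorem mem_freeComponent_of_mem_component {d : ℕ} {a : limLie k S} (ha : a ∈ component k S d)
    (F : Finset S) : a.1 F ∈ freeComponent k F d :=
  (show a.1 ∈ limComponent k S d from ha).1 F

theorem eq_zero_of_mem_component_zero {a : limLie k S} (ha : a ∈ component k S 0) : a = 0 :=
  Subtype.ext (funext fun F => eq_zero_of_mem_freeComponent_zero
    (mem_freeComponent_of_mem_component ha F))

theorem iSup_component : ⨆ d, component k S d = ⊤ := by
  rw [eq_top_iff]
  rintro ⟨a, ha⟩ _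
  have ha' : a ∈ ⨆ d, limComponent k S d := ha
  have hle : (⨆ d, limComponent k S d) ≤
      (⨆ d, component k S d).map (limLie k S).toSubmodule.subtype := by
    rw [iSup_le_iff]
    intro d b hb
    exact ⟨⟨b, Submodule.mem_iSup_of_mem d hb⟩, Submodule.mem_iSup_of_mem d hb, rfl⟩
  obtain ⟨b, hb, rfl⟩ := hle ha'
  exact hb

theorem limMul_apply {d : ℕ} {a : limLie k S} (ha : a ∈ component k S d) (b : List S → k)
    (w : List S) : limMul k S a b w =
      if d ≤ w.length then limMul k S a (emptyWord k S) (w.take d) * b (w.drop d) else 0 := by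
  classical
  have hw : ∀ s ∈ w, s ∈ w.toFinset := fun s hs => List.mem_toFinset.2 hs
  rw [limMul_apply_of_subset a b hw, leftMul_apply (mem_freeComponent_of_mem_component ha _),
    limMul_apply_of_subset a _ fun s hs => hw s (List.mem_of_mem_take hs)]

/-- The Dynkin map in degree `d`, from formal sums of words to `L((S))`. -/
def limDynkin (k : Type*) [CommRing k] (S : Type*) (d : ℕ) : (List S → k) →ₗ[k] limLie k S :=
  (LinearMap.pi fun F => dynkin k F d).codRestrict (limLie k S).toSubmodule fun b =>
    Submodule.mem_iSup_of_mem d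
      ⟨fun F => dynkin_mem F d b, fun _ _ hF => restrict_dynkin hF d b⟩

theorem limDynkin_congr {d : ℕ} {b b' : List S → k} (h : ∀ w : List S, w.length = d → b w = b' w) :
    limDynkin k S d b = limDynkin k S d b' :=
  Subtype.ext (funext fun _ => dynkin_congr fun w hw _ => h w hw)

theorem limDynkin_limMul {i : ℕ} {a : limLie k S} (ha : a ∈ component k S i) {d : ℕ}
    (hd : 1 ≤ d) (b : List S → k) :
    limDynkin k S (i + d) (limMul k S a b) = ⁅a, limDynkin k S d b⁆ := by
  refine Subtype.ext (funext fun F => ?_)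
  change dynkin k F (i + d) (limMul k S a b) = ⁅a.1 F, dynkin k F d b⁆
  rw [← dynkin_leftMul (mem_freeComponent_of_mem_component ha F) hd]
  exact dynkin_congr fun w _ hw => limMul_apply_of_subset a b hw

theorem limDynkin_limMul_emptyWord {i : ℕ} {a : limLie k S} (ha : a ∈ component k S i) :
    limDynkin k S i (limMul k S a (emptyWord k S)) = i • a := by
  refine Subtype.ext (funext fun F => ?_)
  change dynkin k F i (limMul k S a (emptyWord k S)) = i • a.1 F
  rw [← dynkin_leftMul_emptyWord (mem_freeComponent_of_mem_component ha F)]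
  exact dynkin_congr fun w _ hw => limMul_apply_of_subset a _ hw

theorem limDynkin_limMul_emptyWord_of_ne {i d : ℕ} (hid : i ≠ d) {a : limLie k S}
    (ha : a ∈ component k S i) :
    limDynkin k S d (limMul k S a (emptyWord k S)) = 0 := by
  rw [← map_zero (limDynkin k S d)]
  refine limDynkin_congr fun w hw => ?_
  rw [limMul_apply ha]
  split_ifs with h
  · have : w.drop i ≠ [] := by
      intro h0
      rw [List.drop_eq_nil_iff] at h0
      omega
    simp [emptyWord, this]
  · rfl

end Limit

/-! ### Generation and freeness. -/

section Free

variable {k : Type*} [Field k] [CharZero k] {S : Type*} {X : Set (limLie k S)}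

theorem lift_surjective (hX : ∀ x ∈ X, IsHomogeneous x)
    (hspan : Submodule.span k (Set.range (fun x : X => abProj k (x : limLie k S))) = ⊤) :
    Function.Surjective (FreeLieAlgebra.lift k (fun x : X => (x : limLie k S))) := by
  set H := (FreeLieAlgebra.lift k (fun x : X => (x : limLie k S))).range with hH
  have hXH : ∀ x ∈ X, x ∈ H := fun x hx =>
    ⟨FreeLieAlgebra.of k ⟨x, hx⟩, FreeLieAlgebra.lift_of_apply _ _⟩
  have hsup : Submodule.span k X ⊔
      (⁅(⊤ : LieIdeal k (limLie k S)), (⊤ : LieIdeal k (limLie k S))⁆).toSubmodule = ⊤ := by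
    have h1 : Set.range (fun x : X => abProj k (x : limLie k S)) =
        (⁅(⊤ : LieIdeal k (limLie k S)), (⊤ : LieIdeal k (limLie k S))⁆).toSubmodule.mkQ '' X := by
      ext y
      simp [abProj, Set.mem_image]
    rw [h1, Submodule.span_image] at hspan
    rw [sup_comm, ← Submodule.comap_map_mkQ, hspan, Submodule.comap_top]
  have hcomp : ∀ d, ∀ a ∈ component k S d, a ∈ H := by
    intro d
    induction d using Nat.strong_induction_on with
    | _ d ih =>
    intro a ha
    rcases Nat.eq_zero_or_pos d with rfl | hd
    · rw [eq_zero_of_mem_component_zero ha]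
      exact zero_mem _
    -- `T` is `d` times the projection to degree `d`.
    let T : Module.End k (limLie k S) := limDynkin k S d ∘ₗ LinearMap.applyₗ (emptyWord k S) ∘ₗ
      (limMul k S).toLinearMap
    have hTeq : ∀ b ∈ component k S d, T b = d • b := fun b hb => limDynkin_limMul_emptyWord hb
    have hTne : ∀ i, i ≠ d → ∀ b ∈ component k S i, T b = 0 := fun i hi b hb =>
      limDynkin_limMul_emptyWord_of_ne hi hb
    have hTH : ∀ i, ∀ b ∈ component k S i, (i = d → b ∈ H) → T b ∈ H := by
      intro i b hb hbH
      by_cases hi : i = d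
      · rw [hTeq b (hi ▸ hb)]
        exact nsmul_mem (hbH hi) d
      · rw [hTne i hi b hb]
        exact zero_mem _
    -- The two factors of a nonzero bracket in degree `d` have degrees below `d`.
    have hlie : ∀ b c : limLie k S, T ⁅b, c⁆ ∈ H := by
      intro b c
      have hb : b ∈ ⨆ d, component k S d := by simp [iSup_component]
      have hc : c ∈ ⨆ d, component k S d := by simp [iSup_component]
      induction hb using Submodule.iSup_induction' with
      | mem i b hb =>
        induction hc using Submodule.iSup_induction' with
        | mem j c hc =>
          refine hTH _ _ (lie_mem_component hb hc) fun hij => ?_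
          rcases Nat.eq_zero_or_pos i with rfl | hi
          · rw [eq_zero_of_mem_component_zero hb, zero_lie]
            exact zero_mem _
          rcases Nat.eq_zero_or_pos j with rfl | hj
          · rw [eq_zero_of_mem_component_zero hc, lie_zero]
            exact zero_mem _
          exact H.lie_mem (ih i (by omega) b hb) (ih j (by omega) c hc)
        | zero => simp
        | add c c' _ _ hc hc' => rw [lie_add, map_add]; exact add_mem hc hc'
      | zero => simp
      | add b b' _ _ hb hb' => rw [add_lie, map_add]; exact add_mem hb hb'
    have hle : Submodule.span k X ⊔
        (⁅(⊤ : LieIdeal k (limLie k S)), (⊤ : LieIdeal k (limLie k S))⁆).toSubmodule ≤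
        H.toSubmodule.comap T := by
      refine sup_le (Submodule.span_le.2 fun x hx => ?_) ?_
      · obtain ⟨i, hi⟩ := hX x hx
        exact hTH i x hi fun _ => hXH x hx
      · rw [LieSubmodule.lieIdeal_oper_eq_linear_span, Submodule.span_le]
        rintro _ ⟨b, c, rfl⟩
        exact hlie b c
    rw [hsup] at hle
    have hT : T a ∈ H := hle (Submodule.mem_top (x := a))
    rw [hTeq a ha, ← Nat.cast_smul_eq_nsmul k] at hT
    have hd0 : (d : k) ≠ 0 := by exact_mod_cast hd.ne'
    have := H.smul_mem (d : k)⁻¹ hT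
    rwa [smul_smul, inv_mul_cancel₀ hd0, one_smul] at this
  intro a
  have hle : (⨆ d, component k S d) ≤ H.toSubmodule := iSup_le hcomp
  rw [iSup_component] at hle
  exact hle (Submodule.mem_top (x := a))

/-- Elements of `L((S))` that are independent modulo brackets are right independent over the algebra
of formal sums of words. -/
theorem eq_zero_of_sum_limMul_eq_zero (hX : ∀ x ∈ X, IsHomogeneous x)
    (hli : LinearIndependent k (fun x : X => abProj k (x : limLie k S))) (b : X →₀ (List S → k))
    (hb : (b.sum fun x c => limMul k S x c) = 0) : b = 0 := by
  choose! deg hdeg using hX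
  have hdeg' : ∀ x : X, (x : limLie k S) ∈ component k S (deg x) := fun x => hdeg x x.2
  suffices h : ∀ e, ∀ w : List S, w.length = e → ∀ x, b x w = 0 by
    ext x w
    exact h _ w rfl x
  intro e
  induction e using Nat.strong_induction_on with
  | _ e ih =>
  intro w hw x
  by_cases hx : x ∈ b.support
  swap
  · rw [Finsupp.notMem_support_iff.1 hx, Pi.zero_apply]
  let d := deg x
  -- The part of `b y` that ends in `w`, with `w` removed.
  let c : X → List S → k := fun y v => b y (v ++ w)
  -- In length `d`, `∑ y·c y` has the coefficients of `∑ y·b y` at the words `u ++ w`: the terms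
  -- differ only if `y` reaches into `w`, and then `b y` is taken at a word shorter than `w`, where
  -- it vanishes by induction.
  have hsum : limDynkin k S d (∑ y ∈ b.support, limMul k S y (c y)) = 0 := by
    rw [← map_zero (limDynkin k S d)]
    refine limDynkin_congr fun u hu => ?_
    have hbu := congr_fun hb (u ++ w)
    rw [Finsupp.sum, Finset.sum_apply] at hbu
    rw [Finset.sum_apply, Pi.zero_apply,
      ← show ∑ y ∈ b.support, limMul k S y (b y) (u ++ w) = 0 from hbu]
    refine Finset.sum_congr rfl fun y _ => ?_
    rw [limMul_apply (hdeg' y) (c y), limMul_apply (hdeg' y) (b y)]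
    by_cases h : deg y ≤ u.length
    · rw [if_pos h, if_pos (by rw [List.length_append]; omega), List.take_append_of_le_length h,
        List.drop_append_of_le_length h]
    · rw [if_neg h]
      split_ifs with h'
      · rw [List.length_append] at h'
        rw [ih _ (by rw [List.length_append]; omega) _ List.length_drop y, mul_zero]
      · rfl
  -- Degrees below `d` give brackets, degrees above `d` give nothing.
  have hterm : ∀ y ∈ b.support, abProj k (limDynkin k S d (limMul k S y (c y))) =
      (if deg y = d then b y w * d else 0) • abProj k (y : limLie k S) := by
    intro y _
    rcases lt_trichotomy (deg y) d with hlt | heq | hgt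
    · obtain ⟨m, hm⟩ := Nat.exists_eq_add_of_lt hlt
      rw [if_neg hlt.ne, zero_smul, hm, add_assoc, limDynkin_limMul (hdeg' y) (by omega)]
      exact (LieSubmodule.Quotient.mk_eq_zero _).2
        (LieSubmodule.lie_mem_lie (LieSubmodule.mem_top _) (LieSubmodule.mem_top _))
    · have : limDynkin k S d (limMul k S y (c y)) = (b y w * d) • (y : limLie k S) := by
        rw [mul_smul, Nat.cast_smul_eq_nsmul, ← heq, ← limDynkin_limMul_emptyWord (hdeg' y),
          ← map_smul]
        refine limDynkin_congr fun u hu => ?_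
        rw [limMul_apply (hdeg' y), if_pos hu.ge, Pi.smul_apply, smul_eq_mul,
          List.take_of_length_le hu.le, List.drop_of_length_le hu.le, mul_comm]
        rfl
      rw [if_pos heq, this]
      rfl
    · have : limDynkin k S d (limMul k S y (c y)) = 0 := by
        rw [← map_zero (limDynkin k S d)]
        refine limDynkin_congr fun u hu => ?_
        rw [limMul_apply (hdeg' y), if_neg (by omega)]
        rfl
      rw [this, if_neg hgt.ne', zero_smul]
      rfl
  have hrel : ∑ y ∈ b.support, (if deg y = d then b y w * d else 0) •
      abProj k (y : limLie k S) = 0 := by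
    rw [← Finset.sum_congr rfl hterm]
    rw [map_sum] at hsum
    have := congrArg (LieSubmodule.Quotient.mk'
      ⁅(⊤ : LieIdeal k (limLie k S)), (⊤ : LieIdeal k (limLie k S))⁆) hsum
    rw [map_sum, map_zero] at this
    exact this
  have hx0 := linearIndependent_iff'.1 hli _ _ hrel x hx
  rw [if_pos rfl, mul_eq_zero] at hx0
  refine hx0.resolve_right fun hd => hli.ne_zero x ?_
  have hd0 : deg x = 0 := by exact_mod_cast hd
  have hx1 := hdeg' x
  rw [hd0] at hx1
  rw [eq_zero_of_mem_component_zero hx1]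
  rfl

/-- Elements of `X` have positive degree, so the constant term of a relation vanishes; right
independence then strips the first factor. -/
theorem wordMap_limMul_injective (hX : ∀ x ∈ X, IsHomogeneous x)
    (hli : LinearIndependent k (fun x : X => abProj k (x : limLie k S))) :
    Function.Injective
      (wordMap (fun x : X => limMul k S (x : limLie k S)) (emptyWord k S)) := by
  set f : X → Module.End k (List S → k) := fun x => limMul k S (x : limLie k S) with hf
  rw [injective_iff_map_eq_zero]
  have hXpos : ∀ (x : X) (b : List S → k), f x b [] = 0 := by
    intro x b
    obtain ⟨d, hd⟩ := hX x x.2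
    rcases Nat.eq_zero_or_pos d with rfl | hpos
    · exact absurd (by rw [eq_zero_of_mem_component_zero hd]; rfl) (hli.ne_zero x)
    · rw [hf, limMul_apply hd, if_neg (by simpa using hpos.ne')]
  -- Splits a combination by first letter: `tails c x` is the series of what follows `x`.
  let tails : (List X →₀ k) →ₗ[k] (X →₀ (List S → k)) := Finsupp.linearCombination k fun v =>
    match v with
    | [] => 0
    | x :: v => Finsupp.single x (wordValue f (emptyWord k S) v)
  have htails : ∀ c x, tails c x =
      wordMap f (emptyWord k S) (c.comapDomain (List.cons x) (List.cons_injective.injOn)) := by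
    classical
    intro c x
    induction c using Finsupp.induction_linear with
    | zero => simp
    | add c c' hc hc' =>
      rw [Finsupp.comapDomain_add_of_injective List.cons_injective, map_add, map_add,
        Finsupp.add_apply, hc, hc']
    | single v r =>
      rcases v with _ | ⟨y, v⟩
      · have : Finsupp.comapDomain (List.cons x) (Finsupp.single ([] : List X) r)
            List.cons_injective.injOn = 0 := by ext; simp
        rw [this]
        simp [tails]
      · by_cases hxy : y = x
        · subst hxy
          rw [Finsupp.comapDomain_single]
          simp [tails, wordMap]
        · have : Finsupp.comapDomain (List.cons x) (Finsupp.single (y :: v) r)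
            List.cons_injective.injOn = 0 := by ext; simp [hxy]
          rw [this]
          simp [tails, hxy]
  have hsplit : ∀ c, wordMap f (emptyWord k S) c =
      c [] • emptyWord k S + (tails c).sum fun x b => f x b := by
    intro c
    induction c using Finsupp.induction_linear with
    | zero => simp
    | add c c' hc hc' =>
      rw [map_add, map_add, Finsupp.sum_add_index' (by simp) (by simp), hc, hc',
        Finsupp.add_apply, add_smul]
      abel
    | single v r =>
      rcases v with _ | ⟨y, v⟩
      · simp [tails, wordMap, wordValue]
      · simp [tails, wordMap, wordValue, Finsupp.sum_single_index]
  intro c hc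
  ext v
  induction v generalizing c with
  | nil =>
    have h := congr_fun (hsplit c) []
    rw [hc, Pi.add_apply, Finsupp.sum, Finset.sum_apply,
      Finset.sum_eq_zero fun x _ => hXpos x _] at h
    simpa [emptyWord] using h.symm
  | cons x v ih =>
    have h0 : c [] = 0 := by
      have h := congr_fun (hsplit c) []
      rw [hc, Pi.add_apply, Finsupp.sum, Finset.sum_apply,
        Finset.sum_eq_zero fun x _ => hXpos x _] at h
      simpa [emptyWord] using h.symm
    have h := hsplit c
    rw [hc, h0, zero_smul, zero_add] at h
    have ht := eq_zero_of_sum_limMul_eq_zero hX hli (tails c) h.symm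
    have := ih (c.comapDomain (List.cons x) List.cons_injective.injOn)
      (by rw [← htails, ht, Finsupp.zero_apply])
    simpa using this

theorem lift_injective (hX : ∀ x ∈ X, IsHomogeneous x)
    (hli : LinearIndependent k (fun x : X => abProj k (x : limLie k S))) :
    Function.Injective (FreeLieAlgebra.lift k (fun x : X => (x : limLie k S))) := by
  rw [injective_iff_map_eq_zero]
  intro a ha
  have hcomp : (limMul k S).comp (FreeLieAlgebra.lift k (fun x : X => (x : limLie k S))) =
      FreeLieAlgebra.lift k (fun x : X => limMul k S (x : limLie k S)) := by
    ext x : 1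
    simp
  refine eq_zero_of_wordAction_eq_zero (wordMap_limMul_injective hX hli ?_)
  rw [wordMap_wordAction, ← hcomp, LieHom.comp_apply, ha]
  simp

end Free

end ProFreeLie

end

theorem mainTheorem3 {k : Type*} [Field k] [CharZero k] (S : Type*)
    (X : Set (ProFreeLie.limLie k S))
    (hX : ∀ x ∈ X, ProFreeLie.IsHomogeneous x)
    (hli : LinearIndependent k (fun x : X => ProFreeLie.abProj k (x : ProFreeLie.limLie k S)))
    (hspan : Submodule.span k
      (Set.range (fun x : X => ProFreeLie.abProj k (x : ProFreeLie.limLie k S))) = ⊤) :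
    ProFreeLie.IsFreelyGeneratedBy k X :=
  ⟨ProFreeLie.lift_injective hX hli, ProFreeLie.lift_surjective hX hspan⟩
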